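/- Let $n,m\ge 1$ be integers and let $q(z,w)=\sum_{j=0}^{n}\sum_{k=0}^{m}a_{jk}z^jw^k$ be a complex polynomial of degree at most $n$ in $z$ and at most $m$ in $w$, with no zeros on the closed bidisk $\overline{\mathbb D}^2$. Let $\sigma$ be normalized Lebesgue measure on $\mathbb T^2$ and let $$d\mu=\frac{c^2}{|q|^2}\,d\sigma ,$$ where $c>0$ is chosen so that $\mu$ is a probability measure. Write $\langle f,g\rangle_\mu=\int_{\mathbb T^2} f\bar g\,d\mu$, and for subspaces $V,W$ of $L^2(\mathbb T^2)$ let $V\ominus_\mu W=\{f\in V:\langle f,g\rangle_\mu=0\text{ for all }g\in W\}$. In the Hardy space $H^2(\mathbb T^2)$ define the closed subspaces $$\mathbf B=\overline{\operatorname{span}}\{z^jw^k: j,k\ge 0,\ j\le n-1\text{ or }k\le m-1\},$$ $$\mathbf{BB}=\overline{\operatorname{span}}\{z^jw^k: j\ge 0,\ 0\le k\le m-1\},\qquad \mathbf{LB}=\overline{\operatorname{span}}\{z^jw^k: k\ge 0,\ 0\le j\le n-1\}.$$ For integers $a,b\ge 0$ let $\mathcal P_{a,b}=\operatorname{span}\{z^jw^k:0\le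 j\le a,\ 0\le k\le b\}$, and let $\mathcal P_{n,m}^{\circ}=\operatorname{span}\{z^jw^k:0\le j\le n,\ 0\le k\le m,\ (j,k)\ne(n,m)\}$. Then $$\mathbf B\ominus_\mu\mathbf{BB}\subset \mathbf{LB}\ominus_\mu\mathcal P_{n-1,m-1},\qquad \mathbf B\ominus_\mu\mathbf{LB}\subset \mathbf{BB}\ominus_\mu\mathcal P_{n-1,m-1},$$ and $$\mathcal P_{n,m}^{\circ}\ominus_\mu\mathcal P_{n,m-1}=\mathcal P_{n-1,m}\ominus_\mu\mathcal P_{n-1,m-1},\qquad \mathcal P_{n,m}^{\circ}\ominus_\mu\mathcal P_{n-1,m}=\mathcal P_{n,m-1}\ominus_\mu\mathcal P_{n-1,m-1}.$$ -/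

import Mathlib

open MeasureTheory

noncomputable section

namespace BernsteinSzego

/-- The 2-torus, with `x = (s, t)` standing for the point `(z, w) = (exp (2πis), exp (2πit))`. -/
abbrev Torus : Type := UnitAddTorus (Fin 2)

/-- The point `(z, w)` of `ℂ²` that corresponds to a point of the 2-torus. -/
def torusPoint (x : Torus) : Fin 2 → ℂ := fun i => (AddCircle.toCircle (x i) : ℂ)

lemma continuous_torusPoint : Continuous torusPoint := by
  unfold torusPoint
  refine continuous_pi fun i => ?_
  exact continuous_subtype_val.comp (AddCircle.continuous_toCircle.comp (continuous_apply i))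

/-- Normalized Lebesgue measure on the 2-torus: the product of the Haar probability measures of
the two circles, i.e. `(2πi)⁻² (dz/z) (dw/w)`. -/
abbrev lebesgue : Measure Torus :=
  Measure.pi fun _ : Fin 2 => (AddCircle.haarAddCircle : Measure UnitAddCircle)

/-- The Hilbert space `L²(𝕋²)` for normalized Lebesgue measure. -/
abbrev L2 : Type := Lp ℂ 2 lebesgue

/-- The function `z ^ j * w ^ k` on the 2-torus. -/
def monomialMap (j k : ℕ) : C(Torus, ℂ) where
  toFun x := torusPoint x 0 ^ j * torusPoint x 1 ^ k
  continuous_toFun :=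
    (((continuous_apply 0).comp continuous_torusPoint).pow j).mul
      (((continuous_apply 1).comp continuous_torusPoint).pow k)

/-- The monomial `z ^ j * w ^ k` as an element of `L²(𝕋²)`. -/
def monomialL2 (j k : ℕ) : L2 := ContinuousMap.toLp (E := ℂ) 2 lebesgue ℂ (monomialMap j k)

/-- The linear span in `L²(𝕋²)` of the monomials `z ^ j * w ^ k` with `(j, k) ∈ S`. -/
def monomialSpan (S : Set (ℕ × ℕ)) : Submodule ℂ L2 :=
  Submodule.span ℂ ((fun p : ℕ × ℕ => monomialL2 p.1 p.2) '' S)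

/-- The closed linear span of the monomials `z ^ j * w ^ k` with `(j, k) ∈ S`. The Hardy space
`H²(𝕋²)` is the case `S = Set.univ`; as it is closed in `L²(𝕋²)`, closures taken in either of
the two spaces agree. -/
def monomialClosedSpan (S : Set (ℕ × ℕ)) : Submodule ℂ L2 :=
  (monomialSpan S).topologicalClosure

/-- The border subspace **B**. -/
def border (n m : ℕ) : Submodule ℂ L2 := monomialClosedSpan {p | p.1 < n ∨ p.2 < m}

/-- The bottom border subspace **BB**. -/
def bottomBorder (m : ℕ) : Submodule ℂ L2 := monomialClosedSpan {p | p.2 < m}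

/-- The left border subspace **LB**. -/
def leftBorder (n : ℕ) : Submodule ℂ L2 := monomialClosedSpan {p | p.1 < n}

/-- Polynomials of degree `(n, m)` without a `z ^ n * w ^ m` term (the box `[0,n] × [0,m]`
without its upper right corner). -/
def boxNoCorner (n m : ℕ) : Submodule ℂ L2 :=
  monomialSpan {p | p.1 ≤ n ∧ p.2 ≤ m ∧ p ≠ (n, m)}

/-- Polynomials of degree `(n, m - 1)` (the box without its upper row). -/
def boxNoTop (n m : ℕ) : Submodule ℂ L2 := monomialSpan {p | p.1 ≤ n ∧ p.2 < m}

/-- Polynomials of degree `(n - 1, m)` (the box without its right column). -/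
def boxNoRight (n m : ℕ) : Submodule ℂ L2 := monomialSpan {p | p.1 < n ∧ p.2 ≤ m}

/-- Polynomials of degree `(n - 1, m - 1)` (the box without its upper row and right column). -/
def boxSmall (n m : ℕ) : Submodule ℂ L2 := monomialSpan {p | p.1 < n ∧ p.2 < m}

/-- The measure `c² / |q|²` times normalized Lebesgue measure on the 2-torus. -/
def bsMeasure (q : MvPolynomial (Fin 2) ℂ) (c : ℝ) : Measure Torus :=
  lebesgue.withDensity fun x =>
    ENNReal.ofReal (c ^ 2 / ‖MvPolynomial.eval (torusPoint x) q‖ ^ 2)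

/-- The inner product `⟨f, g⟩_μ = ∫ f ḡ dμ`, for `f, g ∈ L²(𝕋²)` and a measure `μ` with a bounded
density with respect to Lebesgue measure. -/
def innerOf (μ : Measure Torus) (f g : L2) : ℂ := ∫ x, f x * (starRingEnd ℂ) (g x) ∂μ

/-- `V ⊖_μ W`: the elements of `V` that are orthogonal to `W` in the inner product of `μ`. -/
def ominus (μ : Measure Torus) (V W : Submodule ℂ L2) : Set L2 :=
  {f | f ∈ V ∧ ∀ g ∈ W, innerOf μ f g = 0}

end BernsteinSzego

end

noncomputable section

namespace BernsteinSzego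

open UnitAddTorus

/-! Since `q` has no zeros on the closed bidisk, `r = 1/q` is a uniform limit of polynomials on the
torus (`exists_inv_mem_bidiskAlgebra`). Multiplication by `r` therefore only raises Fourier
frequencies and multiplication by `r̄` only lowers them. Up to the factor `c²`, orthogonality for
`μ` is orthogonality to `F = |r|² f = f/|q|²` in the unweighted `L²`, and every space in the theorem
is the set of functions with Fourier support in a given region.

The heart is `coeff_eq_zero_of_coeff_div_eq_zero`. If `f ∈ B` is orthogonal to `BB`, then `F` has no
frequencies with `p i ≥ 0`, `0 ≤ p i' < m`. Since `q̄F = rf` has no frequencies with `p i' < 0`, the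
degree bound on `q` forces the part `G` of `F` in `p i ≥ 0`, `p i' < 0` to vanish as well. Then `qF
= r̄f` has no frequencies with `p i ≥ n`, and neither has `f = q̄(qF)`. This gives the first two
inclusions, the coordinates `i`, `i'` being interchangeable.

The box identities follow by projections: the inclusion upgrades orthogonality to the small box, for
elements of `LB`, to orthogonality to all of `BB` (`inner_eq_zero_of_mem_weightedOrtho`). -/

/-! ### Fourier coefficients and subspaces with prescribed Fourier support -/

/-- The character `x ↦ z ^ p 0 * w ^ p 1` as an element of `L²(𝕋²)`. -/
def character (p : Fin 2 → ℤ) : L2 := ContinuousMap.toLp (E := ℂ) 2 lebesgue ℂ (mFourier p)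

/-- The characters form a Hilbert basis of `L²(𝕋²)`. -/
def characterBasis : HilbertBasis (Fin 2 → ℤ) ℂ L2 := mFourierBasis (d := Fin 2)

lemma characterBasis_apply (p : Fin 2 → ℤ) : characterBasis p = character p :=
  congrFun (coe_mFourierBasis (d := Fin 2)) p

/-- The Fourier coefficient of `f` at `p`. -/
def coeff (f : L2) (p : Fin 2 → ℤ) : ℂ := inner ℂ (character p) f

lemma coeff_eq_repr (f : L2) (p : Fin 2 → ℤ) : coeff f p = characterBasis.repr f p := by
  rw [HilbertBasis.repr_apply_apply, characterBasis_apply, coeff]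

lemma coeff_character (p p' : Fin 2 → ℤ) : coeff (character p') p = if p = p' then 1 else 0 := by
  rw [coeff, ← characterBasis_apply, ← characterBasis_apply]
  exact orthonormal_iff_ite.mp characterBasis.orthonormal p p'

lemma hasSum_coeff (f : L2) : HasSum (fun p => coeff f p • character p) f := by
  simpa only [← coeff_eq_repr, characterBasis_apply] using characterBasis.hasSum_repr f

@[simp] lemma coeff_zero (p : Fin 2 → ℤ) : coeff 0 p = 0 := inner_zero_right _

@[simp] lemma coeff_add (f g : L2) (p : Fin 2 → ℤ) : coeff (f + g) p = coeff f p + coeff g p :=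
  inner_add_right _ _ _

@[simp] lemma coeff_sub (f g : L2) (p : Fin 2 → ℤ) : coeff (f - g) p = coeff f p - coeff g p :=
  inner_sub_right _ _ _

@[simp] lemma coeff_smul (a : ℂ) (f : L2) (p : Fin 2 → ℤ) : coeff (a • f) p = a * coeff f p :=
  inner_smul_right _ _ _

/-- The elements of `L²(𝕋²)` whose Fourier coefficients vanish off `S`. -/
def supported (S : Set (Fin 2 → ℤ)) : Submodule ℂ L2 where
  carrier := {f | ∀ p, p ∉ S → coeff f p = 0}
  add_mem' hf hg p hp := by rw [coeff_add, hf p hp, hg p hp, add_zero]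
  zero_mem' p _ := coeff_zero p
  smul_mem' a f hf p hp := by rw [coeff_smul, hf p hp, mul_zero]

lemma mem_supported {S : Set (Fin 2 → ℤ)} {f : L2} :
    f ∈ supported S ↔ ∀ p, p ∉ S → coeff f p = 0 := Iff.rfl

lemma isClosed_supported (S : Set (Fin 2 → ℤ)) : IsClosed (supported S : Set L2) := by
  have : (supported S : Set L2) = ⋂ p, ⋂ (_ : p ∉ S), {f | coeff f p = 0} := by
    ext f
    simp [mem_supported]
  rw [this]
  exact isClosed_iInter fun p => isClosed_iInter fun _ =>
    isClosed_eq (by unfold coeff; fun_prop) continuous_const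

lemma mem_supported_of_subset {S S' : Set (Fin 2 → ℤ)} {f : L2} (hf : f ∈ supported S)
    (h : ∀ p ∈ S, p ∈ S') : f ∈ supported S' :=
  fun p hp => hf p fun hS => hp (h p hS)

lemma character_mem_supported {S : Set (Fin 2 → ℤ)} {p : Fin 2 → ℤ} (hp : p ∈ S) :
    character p ∈ supported S := fun p' hp' => by
  rw [coeff_character, if_neg]
  rintro rfl
  exact hp' hp

lemma supported_eq_closure_span (S : Set (Fin 2 → ℤ)) :
    supported S = (Submodule.span ℂ (character '' S)).topologicalClosure := by
  apply le_antisymm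
  · intro f hf
    refine (Submodule.isClosed_topologicalClosure _).mem_of_tendsto (hasSum_coeff f)
      (Filter.Eventually.of_forall fun s => Submodule.sum_mem _ fun p _ => ?_)
    by_cases hp : p ∈ S
    · exact Submodule.smul_mem _ _
        (Submodule.le_topologicalClosure _ (Submodule.subset_span ⟨p, hp, rfl⟩))
    · rw [hf p hp, zero_smul]
      exact Submodule.zero_mem _
  · refine Submodule.topologicalClosure_minimal _ (Submodule.span_le.mpr ?_) (isClosed_supported S)
    rintro _ ⟨p, hp, rfl⟩
    exact character_mem_supported hp

/-- Cutting down the Fourier support of `f` to `S`. -/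
lemma exists_restrict (S : Set (Fin 2 → ℤ)) (f : L2) :
    ∃ g ∈ supported S, ∀ p ∈ S, coeff g p = coeff f p := by
  have : CompleteSpace (supported S) := (isClosed_supported S).completeSpace_coe
  refine ⟨(supported S).starProjection f, Submodule.coe_mem _, fun p hp => ?_⟩
  rw [coeff, coeff, ← Submodule.inner_starProjection_left_eq_right,
    Submodule.starProjection_eq_self_iff.mpr (character_mem_supported hp)]

/-! ### Multiplication operators -/

/-- Multiplication by a continuous function on `L²(𝕋²)`. -/
def mulOp (φ : C(Torus, ℂ)) : L2 →L[ℂ] L2 :=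
  (ContinuousLinearMap.mul ℂ ℂ).holderL lebesgue ⊤ 2 2
    (ContinuousMap.toLp (E := ℂ) ⊤ lebesgue ℂ φ)

lemma coeFn_mulOp (φ : C(Torus, ℂ)) (f : L2) : mulOp φ f =ᵐ[lebesgue] fun x => φ x * f x := by
  have h1 := (ContinuousLinearMap.mul ℂ ℂ).coeFn_holder (r := 2)
    (ContinuousMap.toLp (E := ℂ) ⊤ lebesgue ℂ φ) f
  have h2 := ContinuousMap.coeFn_toLp (E := ℂ) (p := ⊤) (𝕜 := ℂ) lebesgue φ
  filter_upwards [h1, h2] with x hx1 hx2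
  rw [← hx2]
  exact hx1

lemma continuous_mulOp (f : L2) : Continuous fun φ => mulOp φ f := by
  unfold mulOp
  fun_prop

lemma mulOp_add (φ ψ : C(Torus, ℂ)) (f : L2) : mulOp (φ + ψ) f = mulOp φ f + mulOp ψ f := by
  simp [mulOp]

lemma mulOp_smul (a : ℂ) (φ : C(Torus, ℂ)) (f : L2) : mulOp (a • φ) f = a • mulOp φ f := by
  simp [mulOp]

lemma mulOp_mul (φ ψ : C(Torus, ℂ)) (f : L2) : mulOp (φ * ψ) f = mulOp φ (mulOp ψ f) := by
  apply Lp.ext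
  filter_upwards [coeFn_mulOp (φ * ψ) f, coeFn_mulOp φ (mulOp ψ f), coeFn_mulOp ψ f] with x h1 h2 h3
  rw [h1, h2, h3, ContinuousMap.mul_apply, mul_assoc]

lemma mulOp_one (f : L2) : mulOp 1 f = f := by
  apply Lp.ext
  filter_upwards [coeFn_mulOp 1 f] with x h
  rw [h, ContinuousMap.one_apply, one_mul]

lemma inner_eq_integral (f g : L2) :
    inner ℂ f g = ∫ x, g x * (starRingEnd ℂ) (f x) ∂lebesgue := by
  rw [L2.inner_def]
  rfl

lemma inner_mulOp_star (φ : C(Torus, ℂ)) (f g : L2) :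
    inner ℂ g (mulOp (star φ) f) = inner ℂ (mulOp φ g) f := by
  rw [inner_eq_integral, inner_eq_integral]
  apply integral_congr_ae
  filter_upwards [coeFn_mulOp (star φ) f, coeFn_mulOp φ g] with x h1 h2
  rw [h1, h2, map_mul, ContinuousMap.star_apply]
  simp only [starRingEnd_apply]
  ring

lemma mulOp_toLp (φ ψ : C(Torus, ℂ)) :
    mulOp φ (ContinuousMap.toLp (E := ℂ) 2 lebesgue ℂ ψ) =
      ContinuousMap.toLp (E := ℂ) 2 lebesgue ℂ (φ * ψ) := by
  apply Lp.ext
  filter_upwards [coeFn_mulOp φ (ContinuousMap.toLp (E := ℂ) 2 lebesgue ℂ ψ),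
    ContinuousMap.coeFn_toLp (E := ℂ) (p := 2) (𝕜 := ℂ) lebesgue ψ,
    ContinuousMap.coeFn_toLp (E := ℂ) (p := 2) (𝕜 := ℂ) lebesgue (φ * ψ)] with x h1 h2 h3
  rw [h1, h2, h3, ContinuousMap.mul_apply]

lemma star_mFourier (p : Fin 2 → ℤ) :
    star (mFourier p : C(Torus, ℂ)) = mFourier (-p) := by
  ext x
  rw [mFourier_neg]
  rfl

lemma mulOp_mFourier_character (p p' : Fin 2 → ℤ) :
    mulOp (mFourier p) (character p') = character (p + p') := by
  rw [character, mulOp_toLp, character]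
  congr 1
  ext x
  exact mFourier_add.symm

lemma coeff_mulOp_mFourier (p d : Fin 2 → ℤ) (f : L2) :
    coeff (mulOp (mFourier d) f) p = coeff f (p - d) := by
  have h : (mFourier d : C(Torus, ℂ)) = star (mFourier (-d)) := by rw [star_mFourier, neg_neg]
  rw [coeff, h, inner_mulOp_star, mulOp_mFourier_character, coeff, neg_add_eq_sub]

/-! ### The bidisk algebra and the inverse of `q` -/

/-- Polynomials as continuous functions on the 2-torus. -/
def polyMap : MvPolynomial (Fin 2) ℂ →ₐ[ℂ] C(Torus, ℂ) :=
  MvPolynomial.aeval fun i => mFourier (Pi.single i 1)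

lemma mFourier_single_apply (i : Fin 2) (x : Torus) :
    mFourier (Pi.single i 1) x = torusPoint x i := by
  rw [mFourier_single, fourier_one]
  rfl

lemma polyMap_apply (q : MvPolynomial (Fin 2) ℂ) (x : Torus) :
    polyMap q x = MvPolynomial.eval (torusPoint x) q := by
  induction q using MvPolynomial.induction_on with
  | C a => simp [polyMap, ← MvPolynomial.algebraMap_eq]
  | add p q hp hq => simp [hp, hq]
  | mul_X p i hp => rw [map_mul, ContinuousMap.mul_apply, hp, map_mul, MvPolynomial.eval_X,
      polyMap, MvPolynomial.aeval_X, mFourier_single_apply]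

/-- The bidisk algebra, as an algebra of functions on the 2-torus. -/
def bidiskAlgebra : Subalgebra ℂ C(Torus, ℂ) := polyMap.range.topologicalClosure

/-- In a commutative Banach algebra, a polynomial without zeros on the closed polydisk takes
invertible values on contractions. -/
lemma isUnit_algHom_apply {A : Type*} [NormedCommRing A] [NormedAlgebra ℂ A] [CompleteSpace A]
    [NormOneClass A] (P : MvPolynomial (Fin 2) ℂ →ₐ[ℂ] A)
    (hP : ∀ i, ‖P (MvPolynomial.X i)‖ ≤ 1) {q : MvPolynomial (Fin 2) ℂ}
    (hq : ∀ v : Fin 2 → ℂ, (∀ i, ‖v i‖ ≤ 1) → MvPolynomial.eval v q ≠ 0) : IsUnit (P q) := by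
  by_contra h
  -- A non-unit is killed by some character. Characters are contractive, so the images of the
  -- coordinates form a point of the closed bidisk, and `q` would vanish there.
  obtain ⟨f, hf⟩ := WeakDual.CharacterSpace.exists_apply_eq_zero h
  let F : A →ₐ[ℂ] ℂ := WeakDual.CharacterSpace.equivAlgHom f
  have key : F.comp P = MvPolynomial.aeval fun i => F (P (MvPolynomial.X i)) :=
    MvPolynomial.algHom_ext fun i => by simp
  refine hq (fun i => F (P (MvPolynomial.X i)))
    (fun i => (AlgHom.norm_apply_le_self F _).trans (hP i)) ?_
  rw [← MvPolynomial.coe_aeval_eq_eval]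
  exact (DFunLike.congr_fun key q).symm.trans hf

/-- Gelfand theory is applied in the bidisk algebra and not in `C(𝕋²)`: the inverse must itself be a
limit of polynomials, so that multiplication by it only raises frequencies. -/
lemma exists_inv_mem_bidiskAlgebra {q : MvPolynomial (Fin 2) ℂ}
    (hq : ∀ v : Fin 2 → ℂ, (∀ i, ‖v i‖ ≤ 1) → MvPolynomial.eval v q ≠ 0) :
    ∃ r ∈ bidiskAlgebra, polyMap q * r = 1 := by
  have : CompleteSpace bidiskAlgebra :=
    (Subalgebra.isClosed_topologicalClosure _).completeSpace_coe
  have : NormOneClass bidiskAlgebra := ⟨norm_one (α := C(Torus, ℂ))⟩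
  let P : MvPolynomial (Fin 2) ℂ →ₐ[ℂ] bidiskAlgebra :=
    polyMap.codRestrict _ fun p => Subalgebra.le_topologicalClosure _ ⟨p, rfl⟩
  have hP (i : Fin 2) : ‖P (MvPolynomial.X i)‖ ≤ 1 := by
    change ‖polyMap (MvPolynomial.X i)‖ ≤ 1
    rw [polyMap, MvPolynomial.aeval_X, mFourier_norm]
  obtain ⟨r, hr⟩ := (isUnit_algHom_apply (A := bidiskAlgebra) P hP hq).exists_right_inv
  exact ⟨r, r.2, congrArg Subtype.val hr⟩

lemma bidiskAlgebra_induction {P : C(Torus, ℂ) → Prop} (hclosed : IsClosed {φ | P φ})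
    (hC : ∀ a : ℂ, P (algebraMap ℂ _ a)) (hadd : ∀ φ ψ, P φ → P ψ → P (φ + ψ))
    (hmul : ∀ φ i, P φ → P (φ * mFourier (Pi.single i 1))) {φ : C(Torus, ℂ)}
    (hφ : φ ∈ bidiskAlgebra) : P φ := by
  refine closure_minimal (s := (polyMap.range : Set C(Torus, ℂ))) ?_ hclosed hφ
  rintro _ ⟨q, rfl⟩
  change P (polyMap q)
  induction q using MvPolynomial.induction_on with
  | C a => simpa [← MvPolynomial.algebraMap_eq] using hC a
  | add p q hp hq => rw [map_add]; exact hadd _ _ hp hq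
  | mul_X p i hp =>
    rw [map_mul]
    have := hmul _ i hp
    rwa [polyMap, MvPolynomial.aeval_X]

/-- Each coordinate function shifts frequencies by one unit vector; closedness of `supported S`
carries the invariance from polynomials to uniform limits. -/
lemma mulOp_mem_supported {S : Set (Fin 2 → ℤ)} (hS : ∀ p ∈ S, ∀ i, p + Pi.single i 1 ∈ S)
    {φ : C(Torus, ℂ)} (hφ : φ ∈ bidiskAlgebra) {f : L2} (hf : f ∈ supported S) :
    mulOp φ f ∈ supported S := by
  refine bidiskAlgebra_induction (P := fun φ => ∀ f ∈ supported S, mulOp φ f ∈ supported S)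
    ?_ ?_ ?_ ?_ hφ f hf
  · simp only [Set.ofPred_forall]
    exact isClosed_iInter fun f => isClosed_iInter fun _ =>
      (isClosed_supported S).preimage (continuous_mulOp f)
  · intro a f hf
    rw [Algebra.algebraMap_eq_smul_one, mulOp_smul, mulOp_one]
    exact Submodule.smul_mem _ _ hf
  · intro φ ψ hφ hψ f hf
    rw [mulOp_add]
    exact Submodule.add_mem _ (hφ f hf) (hψ f hf)
  · intro φ i hφ f hf
    rw [mulOp_mul]
    refine hφ _ fun p hp => ?_
    rw [coeff_mulOp_mFourier]
    exact hf _ fun h => hp (by simpa using hS _ h i)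

lemma mulOp_star_mem_supported {S : Set (Fin 2 → ℤ)} (hS : ∀ p ∈ S, ∀ i, p - Pi.single i 1 ∈ S)
    {φ : C(Torus, ℂ)} (hφ : φ ∈ bidiskAlgebra) {f : L2} (hf : f ∈ supported S) :
    mulOp (star φ) f ∈ supported S := by
  refine bidiskAlgebra_induction
    (P := fun φ => ∀ f ∈ supported S, mulOp (star φ) f ∈ supported S) ?_ ?_ ?_ ?_ hφ f hf
  · simp only [Set.ofPred_forall]
    exact isClosed_iInter fun f => isClosed_iInter fun _ =>
      (isClosed_supported S).preimage ((continuous_mulOp f).comp continuous_star)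
  · intro a f hf
    rw [Algebra.algebraMap_eq_smul_one, star_smul, star_one, mulOp_smul, mulOp_one]
    exact Submodule.smul_mem _ _ hf
  · intro φ ψ hφ hψ f hf
    rw [star_add, mulOp_add]
    exact Submodule.add_mem _ (hφ f hf) (hψ f hf)
  · intro φ i hφ f hf
    rw [star_mul', mulOp_mul, star_mFourier]
    refine hφ _ fun p hp => ?_
    rw [coeff_mulOp_mFourier]
    exact hf _ fun h => hp (by simpa using hS _ h i)

/-! ### Fourier coefficients of `q f` and `q̄ f` -/

/-- A multi-index as a frequency. -/
def frequency (d : Fin 2 →₀ ℕ) : Fin 2 → ℤ := fun i => d i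

lemma polyMap_monomial (d : Fin 2 →₀ ℕ) (a : ℂ) :
    polyMap (MvPolynomial.monomial d a) = a • mFourier (frequency d) := by
  ext x
  rw [polyMap_apply, MvPolynomial.eval_monomial, Finsupp.prod_fintype _ _ fun i => pow_zero _,
    ContinuousMap.smul_apply, smul_eq_mul]
  simp [mFourier, frequency, fourier_apply, torusPoint, AddCircle.toCircle_nsmul]

lemma mulOp_polyMap (q : MvPolynomial (Fin 2) ℂ) (f : L2) :
    mulOp (polyMap q) f =
      ∑ d ∈ q.support, MvPolynomial.coeff d q • mulOp (mFourier (frequency d)) f := by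
  conv_lhs => rw [← MvPolynomial.support_sum_monomial_coeff q, map_sum]
  simp only [polyMap_monomial]
  induction q.support using Finset.induction_on with
  | empty => simp [mulOp]
  | insert d s hd ih => rw [Finset.sum_insert hd, Finset.sum_insert hd, mulOp_add, mulOp_smul, ih]

lemma mulOp_star_polyMap (q : MvPolynomial (Fin 2) ℂ) (f : L2) :
    mulOp (star (polyMap q)) f =
      ∑ d ∈ q.support, star (MvPolynomial.coeff d q) • mulOp (mFourier (-frequency d)) f := by
  conv_lhs => rw [← MvPolynomial.support_sum_monomial_coeff q, map_sum]
  simp only [polyMap_monomial]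
  induction q.support using Finset.induction_on with
  | empty => simp [mulOp]
  | insert d s hd ih =>
    rw [Finset.sum_insert hd, Finset.sum_insert hd, star_add, mulOp_add, star_smul, star_mFourier,
      mulOp_smul, ih]

lemma coeff_sum {ι : Type*} (s : Finset ι) (f : ι → L2) (p : Fin 2 → ℤ) :
    coeff (∑ i ∈ s, f i) p = ∑ i ∈ s, coeff (f i) p := inner_sum _ _ _

lemma coeff_mulOp_polyMap_eq_zero {q : MvPolynomial (Fin 2) ℂ} {f : L2} {p : Fin 2 → ℤ}
    (h : ∀ d : Fin 2 →₀ ℕ, (∀ i, d i ≤ q.degreeOf i) → coeff f (p - frequency d) = 0) :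
    coeff (mulOp (polyMap q) f) p = 0 := by
  rw [mulOp_polyMap, coeff_sum]
  refine Finset.sum_eq_zero fun d hd => ?_
  rw [coeff_smul, coeff_mulOp_mFourier, h d fun i => MvPolynomial.monomial_le_degreeOf i hd,
    mul_zero]

lemma coeff_mulOp_star_polyMap_eq_zero {q : MvPolynomial (Fin 2) ℂ} {f : L2} {p : Fin 2 → ℤ}
    (h : ∀ d : Fin 2 →₀ ℕ, (∀ i, d i ≤ q.degreeOf i) → coeff f (p + frequency d) = 0) :
    coeff (mulOp (star (polyMap q)) f) p = 0 := by
  rw [mulOp_star_polyMap, coeff_sum]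
  refine Finset.sum_eq_zero fun d hd => ?_
  rw [coeff_smul, coeff_mulOp_mFourier, sub_neg_eq_add,
    h d fun i => MvPolynomial.monomial_le_degreeOf i hd, mul_zero]

/-! ### The key vanishing lemma -/

/-- If `f` is supported on the border of the quadrant and the Fourier coefficients of
`f / |q|²` vanish on the half-strip `p i ≥ 0`, `0 ≤ p i' < m`, then `f` is supported on
`p i < n`. -/
lemma coeff_eq_zero_of_coeff_div_eq_zero {i i' : Fin 2} (hi : ∀ k, k = i ∨ k = i') (hne : i ≠ i')
    {n m : ℕ} {q : MvPolynomial (Fin 2) ℂ} {r : C(Torus, ℂ)} (hqn : q.degreeOf i ≤ n)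
    (hqm : q.degreeOf i' ≤ m) (hr : r ∈ bidiskAlgebra) (hqr : polyMap q * r = 1) {f : L2}
    (hf : f ∈ supported {p | 0 ≤ p ∧ (p i < n ∨ p i' < m)})
    (h : ∀ p : Fin 2 → ℤ, 0 ≤ p i → 0 ≤ p i' → p i' < m → coeff (mulOp (star r * r) f) p = 0)
    {p : Fin 2 → ℤ} (hp : (n : ℤ) ≤ p i) : coeff f p = 0 := by
  set F := mulOp (star r * r) f with hF
  have hstar : star (polyMap q) * star r = 1 := by
    have := congrArg star hqr
    rwa [star_mul', star_one] at this
  have hA : mulOp (star (polyMap q)) F = mulOp r f := by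
    rw [hF, ← mulOp_mul, ← mul_assoc, hstar, one_mul]
  have hC : mulOp (polyMap q) F = mulOp (star r) f := by
    rw [hF, ← mulOp_mul, mul_left_comm, hqr, mul_one]
  have hfC : mulOp (star (polyMap q)) (mulOp (polyMap q) F) = f := by
    rw [hC, ← mulOp_mul, hstar, mulOp_one]
  have hcases : ∀ (p : Fin 2 → ℤ) (k : Fin 2), (p + Pi.single k 1 : Fin 2 → ℤ) i = p i + 1 ∧
      (p + Pi.single k 1 : Fin 2 → ℤ) i' = p i' ∨ (p + Pi.single k 1 : Fin 2 → ℤ) i = p i ∧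
      (p + Pi.single k 1 : Fin 2 → ℤ) i' = p i' + 1 := by
    intro p k
    rcases hi k with rfl | rfl
    · exact Or.inl ⟨by simp, by simp [hne.symm]⟩
    · exact Or.inr ⟨by simp [hne], by simp⟩
  have hcases' : ∀ (p : Fin 2 → ℤ) (k : Fin 2), (p - Pi.single k 1 : Fin 2 → ℤ) i = p i - 1 ∧
      (p - Pi.single k 1 : Fin 2 → ℤ) i' = p i' ∨ (p - Pi.single k 1 : Fin 2 → ℤ) i = p i ∧
      (p - Pi.single k 1 : Fin 2 → ℤ) i' = p i' - 1 := by
    intro p k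
    rcases hi k with rfl | rfl
    · exact Or.inl ⟨by simp, by simp [hne.symm]⟩
    · exact Or.inr ⟨by simp [hne], by simp⟩
  have hAsupp : mulOp r f ∈ supported {p | 0 ≤ p i'} := by
    refine mulOp_mem_supported (fun p hp k => ?_) hr
      (mem_supported_of_subset hf fun p hp => hp.1 i')
    simp only [Set.mem_ofPred_eq] at hp ⊢
    have := hcases p k
    omega
  have hCsupp : mulOp (star r) f ∈ supported {p | p i < n ∨ p i' < m} := by
    refine mulOp_star_mem_supported (fun p hp k => ?_) hr
      (mem_supported_of_subset hf fun p hp => hp.2)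
    simp only [Set.mem_ofPred_eq] at hp ⊢
    have := hcases' p k
    omega
  -- `G` is the part of `F` in the fourth quadrant, shown below to be zero.
  obtain ⟨G, hG, hGF⟩ := exists_restrict {p | 0 ≤ p i ∧ p i' < 0} F
  have hD : mulOp (star (polyMap q)) G ∈ supported {p | p i < 0} := by
    intro p hp
    simp only [Set.mem_ofPred_eq, not_lt] at hp
    by_cases hp' : 0 ≤ p i'
    · refine coeff_mulOp_star_polyMap_eq_zero fun d _ => hG _ ?_
      simp only [Set.mem_ofPred_eq, Pi.add_apply, frequency]
      omega
    -- From `p i' < 0`, a shift by at most `m` stays below row `m`. There `F` and `G` agree: by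
    -- construction in negative rows, and because both vanish in rows `0` to `m - 1`. So `q̄G` and
    -- `q̄F` have the same coefficient at `p`.
    · have h1 : coeff (mulOp (star (polyMap q)) (G - F)) p = 0 := by
        refine coeff_mulOp_star_polyMap_eq_zero fun d hd => ?_
        rw [coeff_sub, sub_eq_zero]
        have := hd i'
        by_cases h2 : (p + frequency d) i' < 0
        · exact hGF _ ⟨by simp only [Pi.add_apply, frequency]; omega, h2⟩
        · rw [h _ _ (not_lt.mp h2) _, hG _ fun hh => h2 hh.2]
          all_goals simp only [Pi.add_apply, frequency]; omega
      rw [map_sub, coeff_sub, hA, hAsupp p hp', sub_zero] at h1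
      exact h1
  have hG0 : ∀ p, coeff G p = 0 := by
    intro p
    by_cases hp : p i < 0
    · exact hG _ fun hh => by have := hh.1; omega
    -- Multiplying by `r̄ = 1/q̄` lowers frequencies, so `G` itself lives in `p i < 0`, whereas it
    -- was cut to `p i ≥ 0`.
    · have h1 : mulOp (star r) (mulOp (star (polyMap q)) G) ∈ supported {p | p i < 0} := by
        refine mulOp_star_mem_supported (fun p hp k => ?_) hr hD
        simp only [Set.mem_ofPred_eq] at hp ⊢
        have := hcases' p k
        omega
      rw [← mulOp_mul, mul_comm, hstar, mulOp_one] at h1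
      exact h1 p hp
  have hF0 : ∀ p : Fin 2 → ℤ, 0 ≤ p i → p i' < m → coeff F p = 0 := by
    intro p h1 h2
    by_cases h3 : p i' < 0
    · rw [← hGF p ⟨h1, h3⟩, hG0]
    · exact h p h1 (not_lt.mp h3) h2
  have hC0 : ∀ p : Fin 2 → ℤ, (n : ℤ) ≤ p i → coeff (mulOp (polyMap q) F) p = 0 := by
    intro p h1
    by_cases h2 : p i' < m
    · refine coeff_mulOp_polyMap_eq_zero fun d hd => hF0 _ ?_ ?_
      · have := hd i
        simp only [Pi.sub_apply, frequency]
        omega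
      · simp only [Pi.sub_apply, frequency]
        omega
    · rw [hC]
      refine hCsupp p ?_
      simp only [Set.mem_ofPred_eq]
      omega
  rw [← hfC]
  refine coeff_mulOp_star_polyMap_eq_zero fun d _ => hC0 _ ?_
  simp only [Pi.add_apply, frequency]
  omega

/-! ### Orthogonality with weight `|r|²` -/

/-- The elements of `V` whose product with `|r|²` is orthogonal to `W` in `L²(𝕋²)`. -/
def weightedOrtho (r : C(Torus, ℂ)) (V W : Submodule ℂ L2) : Set L2 :=
  {f | f ∈ V ∧ ∀ g ∈ W, inner ℂ g (mulOp (star r * r) f) = 0}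

lemma inner_mulOp_star_mul_self (r : C(Torus, ℂ)) (f g : L2) :
    inner ℂ g (mulOp (star r * r) f) = inner ℂ (mulOp r g) (mulOp r f) := by
  rw [mulOp_mul, inner_mulOp_star]

lemma eq_zero_of_inner_mulOp_self {s r : C(Torus, ℂ)} (h : s * r = 1) {f : L2}
    (hf : inner ℂ f (mulOp (star r * r) f) = 0) : f = 0 := by
  rw [inner_mulOp_star_mul_self, inner_self_eq_zero] at hf
  rw [← mulOp_one f, ← h, mulOp_mul, hf, map_zero]

/-- Orthogonal projection in the inner product with weight `|r|²`. -/
lemma exists_weighted_projection {s r : C(Torus, ℂ)} (h : s * r = 1) {V : Submodule ℂ L2}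
    (hV : IsClosed (V : Set L2)) (f : L2) :
    ∃ p ∈ V, ∀ g ∈ V, inner ℂ g (mulOp (star r * r) (f - p)) = 0 := by
  -- Multiplication by `r` turns the weighted inner product into the usual one. As `s = 1/r`, `V'`
  -- is `rV`: project `rf` onto it and divide by `r`.
  let V' : Submodule ℂ L2 := V.comap (mulOp s : L2 →ₗ[ℂ] L2)
  have hV' : IsClosed (V' : Set L2) := hV.preimage (mulOp s).continuous
  have : CompleteSpace V' := hV'.completeSpace_coe
  have h' : r * s = 1 := by rw [mul_comm, h]
  refine ⟨mulOp s (V'.starProjection (mulOp r f)),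
    Submodule.starProjection_apply_mem V' (mulOp r f), fun g hg => ?_⟩
  rw [inner_mulOp_star_mul_self, map_sub, ← mulOp_mul r s, h', mulOp_one]
  refine V'.sub_starProjection_mem_orthogonal (mulOp r f) _ ?_
  change mulOp s (mulOp r g) ∈ V
  rwa [← mulOp_mul, h, mulOp_one]

section Quadrant

variable {i i' : Fin 2} {n m : ℕ} {q : MvPolynomial (Fin 2) ℂ} {r : C(Torus, ℂ)}

/-- Testing against characters of the bottom border yields the vanishing hypothesis of the key
lemma. -/
theorem weightedOrtho_border_subset (hi : ∀ k, k = i ∨ k = i') (hne : i ≠ i')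
    (hqn : q.degreeOf i ≤ n) (hqm : q.degreeOf i' ≤ m) (hr : r ∈ bidiskAlgebra)
    (hqr : polyMap q * r = 1) :
    weightedOrtho r (supported {p | 0 ≤ p ∧ (p i < n ∨ p i' < m)})
        (supported {p | 0 ≤ p ∧ p i' < m}) ⊆
      weightedOrtho r (supported {p | 0 ≤ p ∧ p i < n})
        (supported {p | 0 ≤ p ∧ p i < n ∧ p i' < m}) := by
  rintro f ⟨hf, h⟩
  refine ⟨fun p hp => ?_, fun g hg =>
    h g (mem_supported_of_subset hg fun p hp => ⟨hp.1, hp.2.2⟩)⟩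
  by_cases hpn : p i < n
  · exact hf p fun hh => hp ⟨hh.1, hpn⟩
  · refine coeff_eq_zero_of_coeff_div_eq_zero hi hne hqn hqm hr hqr hf
      (fun p h1 h2 h3 => h _ (character_mem_supported ⟨fun k => ?_, h3⟩)) (not_lt.mp hpn)
    rcases hi k with rfl | rfl
    · exact h1
    · exact h2

/-- The part of the left border orthogonal to the small box is orthogonal to the whole bottom
border. -/
theorem inner_eq_zero_of_mem_weightedOrtho (hi : ∀ k, k = i ∨ k = i') (hne : i ≠ i')
    (hqn : q.degreeOf i ≤ n) (hqm : q.degreeOf i' ≤ m) (hr : r ∈ bidiskAlgebra)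
    (hqr : polyMap q * r = 1) {f : L2}
    (hf : f ∈ weightedOrtho r (supported {p | 0 ≤ p ∧ p i < n})
      (supported {p | 0 ≤ p ∧ p i < n ∧ p i' < m})) {g : L2}
    (hg : g ∈ supported {p | 0 ≤ p ∧ p i' < m}) :
    inner ℂ g (mulOp (star r * r) f) = 0 := by
  -- With `u` the weighted projection of `f` to the bottom border, `f - u` lies in the left border
  -- by the previous inclusion. So `u` lies in both borders, that is in the small box; being
  -- orthogonal to both `f` and `f - u`, it is zero.
  obtain ⟨u, hu, hfu⟩ := exists_weighted_projection hqr
    (isClosed_supported {p | 0 ≤ p ∧ p i' < m}) f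
  have hmem := (weightedOrtho_border_subset hi hne hqn hqm hr hqr ⟨Submodule.sub_mem _
    (mem_supported_of_subset hf.1 fun p hp => ⟨hp.1, Or.inl hp.2⟩)
    (mem_supported_of_subset hu fun p hp => ⟨hp.1, Or.inr hp.2⟩), hfu⟩).1
  have hu' : u ∈ supported {p | 0 ≤ p ∧ p i < n} := by
    have := Submodule.sub_mem _ hf.1 hmem
    rwa [sub_sub_cancel] at this
  have hu'' : u ∈ supported {p | 0 ≤ p ∧ p i < n ∧ p i' < m} := by
    intro p hp
    by_cases hpn : 0 ≤ p ∧ p i < n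
    · exact hu p fun hh => hp ⟨hh.1, hpn.2, hh.2⟩
    · exact hu' p hpn
  have h0 : u = 0 := by
    refine eq_zero_of_inner_mulOp_self hqr ?_
    have := hfu u hu
    rwa [map_sub, inner_sub_right, hf.2 u hu'', zero_sub, neg_eq_zero] at this
  simpa only [h0, sub_zero] using hfu g hg

theorem weightedOrtho_box_eq (hi : ∀ k, k = i ∨ k = i') (hne : i ≠ i')
    (hqn : q.degreeOf i ≤ n) (hqm : q.degreeOf i' ≤ m) (hr : r ∈ bidiskAlgebra)
    (hqr : polyMap q * r = 1) :
    weightedOrtho r (supported {p | 0 ≤ p ∧ p i ≤ n ∧ p i' ≤ m ∧ ¬(p i = n ∧ p i' = m)})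
        (supported {p | 0 ≤ p ∧ p i ≤ n ∧ p i' < m}) =
      weightedOrtho r (supported {p | 0 ≤ p ∧ p i < n ∧ p i' ≤ m})
        (supported {p | 0 ≤ p ∧ p i < n ∧ p i' < m}) := by
  have key : ∀ f ∈ weightedOrtho r (supported {p | 0 ≤ p ∧ p i < n ∧ p i' ≤ m})
      (supported {p | 0 ≤ p ∧ p i < n ∧ p i' < m}),
      ∀ g ∈ supported {p | 0 ≤ p ∧ p i ≤ n ∧ p i' < m},
      inner ℂ g (mulOp (star r * r) f) = 0 := fun f hf g hg =>
    inner_eq_zero_of_mem_weightedOrtho hi hne hqn hqm hr hqr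
      ⟨mem_supported_of_subset hf.1 (fun p hp => ⟨hp.1, hp.2.1⟩), hf.2⟩
      (mem_supported_of_subset hg fun p hp => ⟨hp.1, hp.2.2⟩)
  apply Set.Subset.antisymm
  · rintro f ⟨hf, h⟩
    -- Cut `f` to `p i < n` and remove its small-box component `v`. The remainder `u - v` lies in
    -- the right-hand space, and `f - (u - v)` is both in and orthogonal to the box without its top
    -- row, hence zero.
    obtain ⟨u, hu, huf⟩ := exists_restrict {p : Fin 2 → ℤ | p i < n} f
    have hu' : u ∈ supported {p | 0 ≤ p ∧ p i < n ∧ p i' ≤ m} := by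
      intro p hp
      by_cases hpn : p i < n
      · exact (huf p hpn).trans (hf p fun hh => hp ⟨hh.1, hpn, hh.2.2.1⟩)
      · exact hu p hpn
    obtain ⟨v, hv, huv⟩ := exists_weighted_projection hqr
      (isClosed_supported {p | 0 ≤ p ∧ p i < n ∧ p i' < m}) u
    have hw : u - v ∈ weightedOrtho r (supported {p | 0 ≤ p ∧ p i < n ∧ p i' ≤ m})
        (supported {p | 0 ≤ p ∧ p i < n ∧ p i' < m}) :=
      ⟨Submodule.sub_mem _ hu'
        (mem_supported_of_subset hv fun p hp => ⟨hp.1, hp.2.1, hp.2.2.le⟩), huv⟩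
    have hfu : f - u ∈ supported {p | 0 ≤ p ∧ p i ≤ n ∧ p i' < m} := by
      intro p hp
      rw [coeff_sub, sub_eq_zero]
      by_cases hpn : p i < n
      · exact (huf p hpn).symm
      -- Only `p i = n` matters here, and there the missing corner excludes `p i' = m`.
      · rw [hu p hpn]
        refine hf p fun hh => hp ⟨hh.1, hh.2.1, ?_⟩
        have := hh.2
        simp only [not_lt] at hpn
        omega
    have hz : f - (u - v) ∈ supported {p | 0 ≤ p ∧ p i ≤ n ∧ p i' < m} := by
      rw [← sub_add]
      exact Submodule.add_mem _ hfu
        (mem_supported_of_subset hv fun p hp => ⟨hp.1, hp.2.1.le, hp.2.2⟩)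
    have h0 : f - (u - v) = 0 := by
      refine eq_zero_of_inner_mulOp_self hqr ?_
      rw [map_sub (mulOp (star r * r)), inner_sub_right, h _ hz, key _ hw _ hz, sub_zero]
    rwa [sub_eq_zero.mp h0]
  · intro f hf
    refine ⟨mem_supported_of_subset hf.1 (fun p hp => ⟨hp.1, hp.2.1.le, hp.2.2, ?_⟩), key f hf⟩
    have := hp.2.1
    omega

end Quadrant

/-! ### Translation of the spaces and of `μ` to Fourier supports and weights -/

/-- A pair of exponents as a frequency. -/
def pairFrequency (s : ℕ × ℕ) : Fin 2 → ℤ := ![s.1, s.2]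

lemma monomialL2_eq_character (s : ℕ × ℕ) :
    monomialL2 s.1 s.2 = character (pairFrequency s) := by
  rw [monomialL2, character]
  congr 1
  ext x
  simp [monomialMap, mFourier, pairFrequency, fourier_apply, torusPoint, AddCircle.toCircle_nsmul]

lemma monomialSpan_eq_span (S : Set (ℕ × ℕ)) :
    monomialSpan S = Submodule.span ℂ (character '' (pairFrequency '' S)) := by
  simp only [monomialSpan, monomialL2_eq_character, Set.image_image]

lemma monomialClosedSpan_eq_supported {S : Set (ℕ × ℕ)} {S' : Set (Fin 2 → ℤ)}
    (h : pairFrequency '' S = S') : monomialClosedSpan S = supported S' := by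
  rw [monomialClosedSpan, monomialSpan_eq_span, h, supported_eq_closure_span]

/-- A finite-dimensional span is already closed. -/
lemma monomialSpan_eq_supported {S : Set (ℕ × ℕ)} (hS : S.Finite) {S' : Set (Fin 2 → ℤ)}
    (h : pairFrequency '' S = S') : monomialSpan S = supported S' := by
  rw [supported_eq_closure_span, ← h, monomialSpan_eq_span]
  have := FiniteDimensional.span_of_finite ℂ ((hS.image pairFrequency).image character)
  exact (Submodule.closed_of_finiteDimensional _).submodule_topologicalClosure_eq.symm

lemma pairFrequency_image {P : ℕ × ℕ → Prop} {Q : (Fin 2 → ℤ) → Prop}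
    (h : ∀ s, P s ↔ Q (pairFrequency s)) : pairFrequency '' {s | P s} = {p | 0 ≤ p ∧ Q p} := by
  ext p
  constructor
  · rintro ⟨s, hs, rfl⟩
    exact ⟨fun k => by fin_cases k <;> simp [pairFrequency], (h s).mp hs⟩
  · rintro ⟨hp, hQ⟩
    have e : pairFrequency ((p 0).toNat, (p 1).toNat) = p := by
      ext k
      fin_cases k
      · exact Int.toNat_of_nonneg (hp 0)
      · exact Int.toNat_of_nonneg (hp 1)
    exact ⟨_, (h _).mpr (by rwa [e]), e⟩

lemma finite_of_le {n m : ℕ} {S : Set (ℕ × ℕ)} (h : ∀ s ∈ S, s.1 ≤ n ∧ s.2 ≤ m) : S.Finite :=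
  ((Set.finite_Iic n).prod (Set.finite_Iic m)).subset fun s hs => ⟨(h s hs).1, (h s hs).2⟩

lemma border_eq (n m : ℕ) : border n m = supported {p | 0 ≤ p ∧ (p 0 < n ∨ p 1 < m)} :=
  monomialClosedSpan_eq_supported (pairFrequency_image (Q := fun p => p 0 < n ∨ p 1 < m)
    fun s => by simp [pairFrequency])

lemma bottomBorder_eq (m : ℕ) : bottomBorder m = supported {p | 0 ≤ p ∧ p 1 < m} :=
  monomialClosedSpan_eq_supported (pairFrequency_image (Q := fun p => p 1 < m)
    fun s => by simp [pairFrequency])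

lemma leftBorder_eq (n : ℕ) : leftBorder n = supported {p | 0 ≤ p ∧ p 0 < n} :=
  monomialClosedSpan_eq_supported (pairFrequency_image (Q := fun p => p 0 < n)
    fun s => by simp [pairFrequency])

lemma boxNoCorner_eq (n m : ℕ) : boxNoCorner n m =
    supported {p | 0 ≤ p ∧ p 0 ≤ n ∧ p 1 ≤ m ∧ ¬(p 0 = n ∧ p 1 = m)} :=
  monomialSpan_eq_supported (finite_of_le fun _ hs => ⟨hs.1, hs.2.1⟩)
    (pairFrequency_image (Q := fun p => p 0 ≤ n ∧ p 1 ≤ m ∧ ¬(p 0 = n ∧ p 1 = m))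
      fun s => by simp [pairFrequency, Prod.ext_iff])

lemma boxNoTop_eq (n m : ℕ) : boxNoTop n m = supported {p | 0 ≤ p ∧ p 0 ≤ n ∧ p 1 < m} :=
  monomialSpan_eq_supported (finite_of_le fun _ hs => ⟨hs.1, hs.2.le⟩)
    (pairFrequency_image (Q := fun p => p 0 ≤ n ∧ p 1 < m) fun s => by simp [pairFrequency])

lemma boxNoRight_eq (n m : ℕ) : boxNoRight n m = supported {p | 0 ≤ p ∧ p 0 < n ∧ p 1 ≤ m} :=
  monomialSpan_eq_supported (finite_of_le fun _ hs => ⟨hs.1.le, hs.2⟩)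
    (pairFrequency_image (Q := fun p => p 0 < n ∧ p 1 ≤ m) fun s => by simp [pairFrequency])

lemma boxSmall_eq (n m : ℕ) : boxSmall n m = supported {p | 0 ≤ p ∧ p 0 < n ∧ p 1 < m} :=
  monomialSpan_eq_supported (finite_of_le fun _ hs => ⟨hs.1.le, hs.2.le⟩)
    (pairFrequency_image (Q := fun p => p 0 < n ∧ p 1 < m) fun s => by simp [pairFrequency])

lemma innerOf_bsMeasure {q : MvPolynomial (Fin 2) ℂ} {r : C(Torus, ℂ)} (hqr : polyMap q * r = 1)
    (c : ℝ) (f g : L2) :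
    innerOf (bsMeasure q c) f g = (c : ℂ) ^ 2 * inner ℂ g (mulOp (star r * r) f) := by
  have hmeas : Measurable fun x : Torus =>
      ENNReal.ofReal (c ^ 2 / ‖MvPolynomial.eval (torusPoint x) q‖ ^ 2) := by
    simp only [← polyMap_apply]
    have := (polyMap q).continuous.measurable
    fun_prop
  rw [innerOf, bsMeasure, integral_withDensity_eq_integral_toReal_smul hmeas
    (Filter.Eventually.of_forall fun _ => ENNReal.ofReal_lt_top), inner_eq_integral,
    ← integral_const_mul]
  apply integral_congr_ae
  filter_upwards [coeFn_mulOp (star r * r) f] with x hx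
  have hx1 : polyMap q x * r x = 1 := DFunLike.congr_fun hqr x
  have hr : ‖r x‖ = ‖polyMap q x‖⁻¹ := by
    rw [eq_inv_of_mul_eq_one_right hx1, norm_inv]
  have hrr : star (r x) * r x = ((‖r x‖ ^ 2 : ℝ) : ℂ) := by
    rw [mul_comm, Complex.star_def, Complex.mul_conj, Complex.normSq_eq_norm_sq]
  rw [hx, ENNReal.toReal_ofReal (by positivity), ← polyMap_apply, ContinuousMap.mul_apply,
    ContinuousMap.star_apply, hrr, hr, Complex.real_smul]
  push_cast
  ring

lemma ominus_bsMeasure {q : MvPolynomial (Fin 2) ℂ} {r : C(Torus, ℂ)} (hqr : polyMap q * r = 1)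
    {c : ℝ} (hc : 0 < c) (V W : Submodule ℂ L2) :
    ominus (bsMeasure q c) V W = weightedOrtho r V W := by
  have : (c : ℂ) ^ 2 ≠ 0 := by exact_mod_cast (pow_pos hc 2).ne'
  simp only [ominus, weightedOrtho, innerOf_bsMeasure hqr, mul_eq_zero, this, false_or]

end BernsteinSzego

end

open BernsteinSzego

theorem mainTheorem3 (n m : ℕ) (hn : 0 < n) (hm : 0 < m)
    (q : MvPolynomial (Fin 2) ℂ)
    (hqn : MvPolynomial.degreeOf 0 q ≤ n) (hqm : MvPolynomial.degreeOf 1 q ≤ m)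
    (hq : ∀ z w : ℂ, ‖z‖ ≤ 1 → ‖w‖ ≤ 1 → MvPolynomial.eval ![z, w] q ≠ 0)
    (c : ℝ) (hc : 0 < c)
    (hμ : MeasureTheory.IsProbabilityMeasure (BernsteinSzego.bsMeasure q c)) :
    BernsteinSzego.ominus (BernsteinSzego.bsMeasure q c)
        (BernsteinSzego.border n m) (BernsteinSzego.bottomBorder m) ⊆
      BernsteinSzego.ominus (BernsteinSzego.bsMeasure q c)
        (BernsteinSzego.leftBorder n) (BernsteinSzego.boxSmall n m) ∧
    BernsteinSzego.ominus (BernsteinSzego.bsMeasure q c)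
        (BernsteinSzego.border n m) (BernsteinSzego.leftBorder n) ⊆
      BernsteinSzego.ominus (BernsteinSzego.bsMeasure q c)
        (BernsteinSzego.bottomBorder m) (BernsteinSzego.boxSmall n m) ∧
    BernsteinSzego.ominus (BernsteinSzego.bsMeasure q c)
        (BernsteinSzego.boxNoCorner n m) (BernsteinSzego.boxNoTop n m) =
      BernsteinSzego.ominus (BernsteinSzego.bsMeasure q c)
        (BernsteinSzego.boxNoRight n m) (BernsteinSzego.boxSmall n m) ∧
    BernsteinSzego.ominus (BernsteinSzego.bsMeasure q c)
        (BernsteinSzego.boxNoCorner n m) (BernsteinSzego.boxNoRight n m) =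
      BernsteinSzego.ominus (BernsteinSzego.bsMeasure q c)
        (BernsteinSzego.boxNoTop n m) (BernsteinSzego.boxSmall n m) := by
  have hq' : ∀ v : Fin 2 → ℂ, (∀ i, ‖v i‖ ≤ 1) → MvPolynomial.eval v q ≠ 0 := fun v hv => by
    have e : v = ![v 0, v 1] := by
      ext k
      fin_cases k <;> rfl
    rw [e]
    exact hq _ _ (hv 0) (hv 1)
  obtain ⟨r, hr, hqr⟩ := exists_inv_mem_bidiskAlgebra hq'
  have h01 : ∀ k : Fin 2, k = 0 ∨ k = 1 := by decide
  have h10 : ∀ k : Fin 2, k = 1 ∨ k = 0 := by decide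
  simp only [ominus_bsMeasure hqr hc, border_eq, bottomBorder_eq, leftBorder_eq, boxNoCorner_eq,
    boxNoTop_eq, boxNoRight_eq, boxSmall_eq]
  refine ⟨weightedOrtho_border_subset h01 zero_ne_one hqn hqm hr hqr, ?_,
    weightedOrtho_box_eq h01 zero_ne_one hqn hqm hr hqr, ?_⟩
  -- The second and fourth claims are the first and third with `z` and `w` exchanged.
  · have := weightedOrtho_border_subset h10 one_ne_zero hqm hqn hr hqr
    simpa only [or_comm, and_comm] using this
  · have := weightedOrtho_box_eq h10 one_ne_zero hqm hqn hr hqr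
    simpa only [and_comm, and_left_comm, and_assoc] using this
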